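/- Let $\mathbf C_2$ be the two-dimensional comb, i.e. the graph with vertex set $\mathbb Z^2$ obtained from the square lattice by removing all horizontal edges off the $x$-axis. Let $(S_n)_{n\ge 0}$, $S_n=(S_n^x,S_n^y)$, be the simple random walk on $\mathbf C_2$ started at $S_0=(0,0)$: the Markov chain which at each step moves from its current vertex to each neighbour with equal probability ($1/4$ from vertices on the $x$-axis, $1/2$ from the others). Let $$D_n^x=\max\{|S_i^x| : 0\le i\le n\}$$ be its maximal horizontal deviation in $n$ steps. Then $D_n^x$ is integrable for every $n$ and, as $n\to\infty$, $$\mathbb E[D_n^x]\sim\frac{2^{-7/4}\,\pi}{\Gamma(5/4)}\;n^{1/4},$$ that is, the ratio of the two sides tends to $1$. -/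

import Mathlib

open MeasureTheory

/-- The two-dimensional comb: the square lattice on `ℤ × ℤ` from which all horizontal edges
off the horizontal axis have been removed. -/
def combGraph : SimpleGraph (ℤ × ℤ) where
  Adj p q := (p.1 = q.1 ∧ |p.2 - q.2| = 1) ∨ (p.2 = 0 ∧ q.2 = 0 ∧ |p.1 - q.1| = 1)
  symm := ⟨by
    rintro p q (⟨h, h'⟩ | ⟨h, h', h''⟩)
    · exact Or.inl ⟨h.symm, by rwa [abs_sub_comm]⟩
    · exact Or.inr ⟨h', h, by rwa [abs_sub_comm]⟩⟩
  loopless := ⟨by rintro p (⟨_, h⟩ | ⟨_, _, h⟩) <;> simp at h⟩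

open Classical in
/-- The one-step transition probabilities of the simple random walk on a (locally finite) graph:
`1 / deg x` if `y` is a neighbour of `x`, and `0` otherwise. -/
noncomputable def srwTransition {V : Type*} (G : SimpleGraph V) (x y : V) : ℝ :=
  if G.Adj x y then 1 / ((G.neighborSet x).ncard : ℝ) else 0

/-- `S` is, under `μ`, a simple random walk on the graph `G` started at `o`: the Markov chain
with initial state `o` and transition probabilities `srwTransition G`. The Markov property
is written without conditional probabilities, as
`P(S₀ = x₀, …, Sₙ₊₁ = xₙ₊₁) = P(S₀ = x₀, …, Sₙ = xₙ) * p(xₙ, xₙ₊₁)`. -/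
structure IsSimpleRandomWalk {V : Type*} [MeasurableSpace V] {Ω : Type*} [MeasurableSpace Ω]
    (G : SimpleGraph V) (o : V) (μ : Measure Ω) (S : ℕ → Ω → V) : Prop where
  measurable : ∀ n, Measurable (S n)
  start : ∀ᵐ ω ∂μ, S 0 ω = o
  step : ∀ (n : ℕ) (x : ℕ → V),
    μ.real {ω | ∀ i ≤ n + 1, S i ω = x i} =
      μ.real {ω | ∀ i ≤ n, S i ω = x i} * srwTransition G (x n) (x (n + 1))

/-- The maximal horizontal deviation `max {|S_i^x| : 0 ≤ i ≤ n}` of a process in `ℤ × ℤ`. -/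
def maxHorizontalDeviation {Ω : Type*} (S : ℕ → Ω → ℤ × ℤ) (n : ℕ) (ω : Ω) : ℤ :=
  (Finset.range (n + 1)).sup' Finset.nonempty_range_add_one fun i => |(S i ω).1|

/-- The four moves: up, down, right, left, the last two replaced by up and down off the axis. -/
def combStep (p : ℤ × ℤ) (u : Fin 4) : ℤ × ℤ :=
  if u = 0 then (p.1, p.2 + 1) else if u = 1 then (p.1, p.2 - 1)
  else if p.2 = 0 then (if u = 2 then (p.1 + 1, p.2) else (p.1 - 1, p.2))
  else (if u = 2 then (p.1, p.2 + 1) else (p.1, p.2 - 1))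

theorem combGraph_degree (p : ℤ × ℤ) :
    (combGraph.neighborSet p).ncard = if p.2 = 0 then 4 else 2 := by
  obtain ⟨a, b⟩ := p
  by_cases hb : b = 0
  · subst hb
    have : combGraph.neighborSet (a, 0) =
        (({(a, 1), (a, -1), (a + 1, 0), (a - 1, 0)} : Finset (ℤ × ℤ)) : Set (ℤ × ℤ)) := by
      ext ⟨c, d⟩
      simp only [SimpleGraph.mem_neighborSet, combGraph, Finset.coe_insert, Finset.coe_singleton,
        Set.mem_insert_iff, Set.mem_singleton_iff, Prod.mk.injEq]
      grind
    rw [this, Set.ncard_coe_finset]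
    rw [Finset.card_insert_of_notMem, Finset.card_insert_of_notMem,
      Finset.card_insert_of_notMem, Finset.card_singleton] <;> simp; omega
  · have : combGraph.neighborSet (a, b) =
        (({(a, b + 1), (a, b - 1)} : Finset (ℤ × ℤ)) : Set (ℤ × ℤ)) := by
      ext ⟨c, d⟩
      simp only [SimpleGraph.mem_neighborSet, combGraph, Finset.coe_insert, Finset.coe_singleton,
        Set.mem_insert_iff, Set.mem_singleton_iff, Prod.mk.injEq]
      grind
    rw [this, Set.ncard_coe_finset]
    simp [hb]
    rw [Finset.card_insert_of_notMem, Finset.card_singleton]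
    simp; omega

theorem combStep_count (p q : ℤ × ℤ) :
    ((Finset.univ.filter fun u => combStep p u = q).card : ℝ) / 4 = srwTransition combGraph p q := by
  rw [srwTransition, combGraph_degree]
  obtain ⟨a, b⟩ := p
  obtain ⟨c, d⟩ := q
  have h : ∀ P : Prop, [Decidable P] → (P ↔ combGraph.Adj (a, b) (c, d)) →
      (Finset.univ.filter fun u => combStep (a, b) u = (c, d)).card =
      if b = 0 then (if P then 1 else 0) else (if P then 2 else 0) := by
    intro P _ hP
    rw [Finset.card_filter, Fin.sum_univ_four]
    have hP' : P ↔ (a = c ∧ |b - d| = 1) ∨ (b = 0 ∧ d = 0 ∧ |a - c| = 1) := hP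
    by_cases hb : b = 0
    · simp only [combStep, hb, Prod.mk.injEq, Fin.isValue, if_true] at hP' ⊢
      simp
      grind
    · simp only [combStep, hb, Prod.mk.injEq, Fin.isValue, if_false] at hP' ⊢
      simp
      grind
  classical
  rw [h (combGraph.Adj (a, b) (c, d)) Iff.rfl]
  by_cases hb : b = 0 <;> by_cases hA : combGraph.Adj (a, b) (c, d) <;>
    simp only [hA, if_true, if_false] <;> simp [hb] <;> norm_num

/-- The definition is not void: there is a simple random walk on the comb. -/
theorem exists_isSimpleRandomWalk_combGraph :
    ∃ (μ : Measure (ℕ → Fin 4)) (S : ℕ → (ℕ → Fin 4) → ℤ × ℤ),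
      IsProbabilityMeasure μ ∧ IsSimpleRandomWalk combGraph (0, 0) μ S := by
  set ν : Measure (Fin 4) := (PMF.uniformOfFintype (Fin 4)).toMeasure with hν
  let S : ℕ → (ℕ → Fin 4) → ℤ × ℤ := fun n ω =>
    Nat.rec (0, 0) (fun k p => combStep p (ω k)) n
  have hS1 : ∀ n ω, S (n + 1) ω = combStep (S n ω) (ω n) := fun _ _ => rfl
  have hU : ∀ p q, ν.real {u | combStep p u = q} = srwTransition combGraph p q := by
    intro p q
    rw [← combStep_count, measureReal_def, hν, PMF.toMeasure_uniformOfFintype_apply _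
      (Set.toFinite _).measurableSet, ENNReal.toReal_div]
    simp [Fintype.card_subtype]
  refine ⟨Measure.infinitePi fun _ => ν, S, inferInstance, ?_, ?_, ?_⟩
  · intro n
    induction n with
    | zero => exact measurable_const
    | succ n ih =>
      have : Measurable fun z : (ℤ × ℤ) × Fin 4 => combStep z.1 z.2 := measurable_of_countable _
      exact this.comp (ih.prodMk (measurable_pi_apply n))
  · exact Filter.Eventually.of_forall fun _ => rfl
  · intro n x
    by_cases hx : x 0 = (0, 0)
    · have key : ∀ m, (Measure.infinitePi fun _ : ℕ => ν).real {ω | ∀ i ≤ m, S i ω = x i} =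
          ∏ i ∈ Finset.range m, srwTransition combGraph (x i) (x (i + 1)) := by
        intro m
        have hset : {ω | ∀ i ≤ m, S i ω = x i} =
            Set.pi (Finset.range m) fun i => {u | combStep (x i) u = x (i + 1)} := by
          ext ω
          simp only [Set.mem_ofPred_eq, Set.mem_pi, Finset.coe_range, Set.mem_Iio]
          constructor
          · intro h i hi
            rw [← h i hi.le, ← hS1, h (i + 1) hi]
          · intro h i
            induction i with
            | zero => intro _; exact hx.symm
            | succ i ih =>
              intro hi
              rw [hS1, ih (by omega)]
              exact h i hi
        rw [hset, measureReal_def, Measure.infinitePi_pi _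
          (fun i _ => (Set.toFinite _).measurableSet), ENNReal.toReal_prod]
        exact Finset.prod_congr rfl fun i _ => hU _ _
      rw [key, key, Finset.prod_range_succ]
    · have : ∀ m, {ω | ∀ i ≤ m, S i ω = x i} = ∅ := by
        intro m
        ext ω
        simp only [Set.mem_ofPred_eq, Set.mem_empty_iff_false, iff_false]
        exact fun h => hx (h 0 (Nat.zero_le _)).symm
      rw [this, this]
      simp

/-! The expected deviation is a partial sum of a nonnegative sequence whose generating function is
explicit, so its growth follows from Karamata's Tauberian theorem.

For the strip `|x| < h` let `T` be the exit time. Put `z = 2 cosh t / (1 + cosh² t)`. The function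
`cosh (t x) (cosh t)^{-|y|}` is reproduced by one step of the walk up to the factor `1 / z`, on the
axis as well as off it, and the strip is left only along the axis. Stopping at `T` gives `E[z^T] = 1
/ cosh (t h)` (`sum_combHarmonic_combStep`, `hasSum_exitProb_mul_pow`).

The mean of `D_n` is the sum over `h ≥ 1` of `P(T ≤ n)`, hence the sum over `k ≤ n` of the
increments `∑_h P(T = k)` (`integral_maxHorizontalDeviation`). Their generating function is `∑_{h ≥
1} 1 / cosh (t h)`, which is asymptotic to `π / (2 t)` as `t → 0` by comparison with an integral.
For `z = e^{-s}` one has `s ~ t⁴ / 8`, so the sum is asymptotic to `8^{-1/4} (π / 2) s^{-1/4}`.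
Karamata's theorem with exponent `1/4` turns this into the claim; dividing by `Γ(5/4)` gives the
constant. -/

/-! ### Karamata's Tauberian theorem -/

/-- The weighted Abel mean `s ^ a * ∑ bₖ e^{-sk} g(e^{-sk})`. -/
noncomputable def abelMean (b : ℕ → ℝ) (a : ℝ) (g : ℝ → ℝ) (s : ℝ) : ℝ :=
  s ^ a * ∑' k : ℕ, b k * Real.exp (-(s * k)) * g (Real.exp (-(s * k)))

/-- The weighted Gamma integral `∫ t ^ (a - 1) e^{-t} g(e^{-t}) dt` over the half-line. -/
noncomputable def gammaMean (a : ℝ) (g : ℝ → ℝ) : ℝ :=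
  ∫ t in Set.Ioi (0 : ℝ), t ^ (a - 1) * Real.exp (-t) * g (Real.exp (-t))

theorem exp_neg_mem_Icc {t : ℝ} (ht : 0 ≤ t) : Real.exp (-t) ∈ Set.Icc (0 : ℝ) 1 :=
  ⟨(Real.exp_pos _).le, Real.exp_le_one_iff.2 (by linarith)⟩

theorem summable_mul_comp_exp {b : ℕ → ℝ} (hb : ∀ k, 0 ≤ b k) {s : ℝ} (hs : 0 < s)
    (hsum : Summable fun k : ℕ => b k * Real.exp (-(s * k))) {g : ℝ → ℝ}
    (hg : ContinuousOn g (Set.Icc 0 1)) :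
    Summable fun k : ℕ => b k * Real.exp (-(s * k)) * g (Real.exp (-(s * k))) := by
  obtain ⟨M, hM⟩ := isCompact_Icc.exists_bound_of_continuousOn hg
  refine Summable.of_norm_bounded (hsum.mul_right M) fun k => ?_
  rw [norm_mul, Real.norm_of_nonneg (mul_nonneg (hb k) (Real.exp_pos _).le)]
  exact mul_le_mul_of_nonneg_left (hM _ (exp_neg_mem_Icc (by positivity)))
    (mul_nonneg (hb k) (Real.exp_pos _).le)

theorem integrableOn_rpow_mul_exp_neg {a : ℝ} (ha : 0 < a) :
    IntegrableOn (fun t : ℝ => t ^ (a - 1) * Real.exp (-t)) (Set.Ioi 0) :=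
  (Real.GammaIntegral_convergent ha).congr_fun (fun _ _ => mul_comm _ _) measurableSet_Ioi

theorem integrableOn_gammaMean {a : ℝ} (ha : 0 < a) {g : ℝ → ℝ}
    (hg : ContinuousOn g (Set.Icc 0 1)) :
    IntegrableOn (fun t : ℝ => t ^ (a - 1) * Real.exp (-t) * g (Real.exp (-t)))
      (Set.Ioi 0) := by
  obtain ⟨M, hM⟩ := isCompact_Icc.exists_bound_of_continuousOn hg
  refine Integrable.mul_bdd (c := M) (integrableOn_rpow_mul_exp_neg ha) ?_ ?_
  · refine ContinuousOn.aestronglyMeasurable ?_ measurableSet_Ioi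
    exact hg.comp (by fun_prop) fun t ht => exp_neg_mem_Icc (le_of_lt ht)
  · exact ae_restrict_of_forall_mem measurableSet_Ioi
      fun t ht => hM _ (exp_neg_mem_Icc (le_of_lt ht))

theorem gammaMean_one (a : ℝ) (ha : 0 < a) : gammaMean a (fun _ => 1) = Real.Gamma a := by
  rw [gammaMean, Real.Gamma_eq_integral ha]
  exact setIntegral_congr_fun measurableSet_Ioi fun t _ => by simp [mul_comm]

theorem gammaMean_pow {a : ℝ} (ha : 0 < a) (j : ℕ) :
    gammaMean a (fun x => x ^ j) = (1 / (1 + j : ℝ)) ^ a * Real.Gamma a := by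
  rw [← Real.integral_rpow_mul_exp_neg_mul_Ioi ha (by positivity), gammaMean]
  refine setIntegral_congr_fun measurableSet_Ioi fun t _ => ?_
  rw [← Real.exp_nat_mul, mul_assoc, ← Real.exp_add]
  ring_nf

/-- The weight `e^{-sk}` times its `j`-th power is `e^{-(1+j)sk}`, so this is the hypothesis at `(1
+ j) s`, rescaled. -/
theorem tendsto_abelMean_pow {b : ℕ → ℝ} {a C : ℝ} (ha : 0 < a)
    (hlim : Filter.Tendsto (abelMean b a fun _ => 1) (nhdsWithin 0 (Set.Ioi 0))
      (nhds (C * Real.Gamma a))) (j : ℕ) :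
    Filter.Tendsto (abelMean b a fun x => x ^ j) (nhdsWithin 0 (Set.Ioi 0))
      (nhds (C * gammaMean a fun x => x ^ j)) := by
  have hj : (0 : ℝ) < 1 + j := by positivity
  have h1 : Filter.Tendsto (fun s : ℝ => (1 + j : ℝ) * s) (nhdsWithin 0 (Set.Ioi 0))
      (nhdsWithin 0 (Set.Ioi 0)) := by
    refine tendsto_nhdsWithin_iff.2 ⟨?_, ?_⟩
    · refine Filter.Tendsto.mono_left ?_ nhdsWithin_le_nhds
      exact Continuous.tendsto' (by fun_prop) _ _ (by simp)
    · filter_upwards [self_mem_nhdsWithin] with s hs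
      exact mul_pos hj hs
  have h2 := (hlim.comp h1).const_mul ((1 / (1 + j : ℝ)) ^ a)
  rw [gammaMean_pow ha]
  refine (h2.congr' ?_).trans (by rw [mul_left_comm])
  filter_upwards [self_mem_nhdsWithin] with s hs
  have hs' : (0 : ℝ) < s := hs
  simp only [Function.comp, abelMean]
  rw [← mul_assoc, ← Real.mul_rpow (by positivity) (by positivity)]
  congr 1
  · congr 1; field_simp
  · refine tsum_congr fun k => ?_
    rw [← Real.exp_nat_mul, mul_assoc (b k) _ (Real.exp _), ← Real.exp_add, mul_one]
    ring_nf

theorem tendsto_abelMean_polynomial {b : ℕ → ℝ} (hb : ∀ k, 0 ≤ b k) {a C : ℝ} (ha : 0 < a)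
    (hsum : ∀ s : ℝ, 0 < s → Summable fun k : ℕ => b k * Real.exp (-(s * k)))
    (hlim : Filter.Tendsto (abelMean b a fun _ => 1) (nhdsWithin 0 (Set.Ioi 0))
      (nhds (C * Real.Gamma a))) (p : Polynomial ℝ) :
    Filter.Tendsto (abelMean b a fun x => p.eval x) (nhdsWithin 0 (Set.Ioi 0))
      (nhds (C * gammaMean a fun x => p.eval x)) := by
  induction p using Polynomial.induction_on' with
  | add p q hp hq =>
    have h : gammaMean a (fun x => (p + q).eval x)
        = gammaMean a (fun x => p.eval x) + gammaMean a (fun x => q.eval x) := by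
      simp only [gammaMean]
      rw [← integral_add (integrableOn_gammaMean ha p.continuousOn)
        (integrableOn_gammaMean ha q.continuousOn)]
      simp only [Polynomial.eval_add, mul_add]
    rw [h, mul_add]
    refine (hp.add hq).congr' ?_
    filter_upwards [self_mem_nhdsWithin] with s hs
    simp only [abelMean]
    rw [← mul_add, ← (summable_mul_comp_exp hb hs (hsum s hs) p.continuousOn).tsum_add
      (summable_mul_comp_exp hb hs (hsum s hs) q.continuousOn)]
    simp only [Polynomial.eval_add, mul_add]
  | monomial j c =>
    have h : gammaMean a (fun x => (Polynomial.monomial j c).eval x)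
        = c * gammaMean a (fun x => x ^ j) := by
      simp only [gammaMean, Polynomial.eval_monomial]
      rw [← integral_const_mul]
      congr 1; ext t; ring
    rw [h, mul_left_comm]
    refine ((tendsto_abelMean_pow ha hlim j).const_mul c).congr fun s => ?_
    simp only [abelMean, Polynomial.eval_monomial]
    rw [mul_left_comm, ← tsum_mul_left]
    congr 2; ext k; ring

/-- Nonnegative coefficients make the mean monotone in `g`, so a uniform error costs only its
multiple of the mean of `1`, which stays bounded as `s → 0`. -/
theorem abs_abelMean_sub_le {b : ℕ → ℝ} (hb : ∀ k, 0 ≤ b k) {a s ε : ℝ} (hs : 0 < s)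
    (hsum : Summable fun k : ℕ => b k * Real.exp (-(s * k))) {f g : ℝ → ℝ}
    (hf : ContinuousOn f (Set.Icc 0 1)) (hg : ContinuousOn g (Set.Icc 0 1))
    (hfg : ∀ x ∈ Set.Icc (0 : ℝ) 1, |f x - g x| ≤ ε) :
    |abelMean b a f s - abelMean b a g s| ≤ ε * abelMean b a (fun _ => 1) s := by
  have h1 := summable_mul_comp_exp hb hs hsum hf
  have h2 := summable_mul_comp_exp hb hs hsum hg
  simp only [abelMean]
  rw [← mul_sub, ← h1.tsum_sub h2, abs_mul, abs_of_nonneg (by positivity : 0 ≤ s ^ a),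
    mul_left_comm]
  refine mul_le_mul_of_nonneg_left ?_ (by positivity)
  rw [← tsum_mul_left, ← Real.norm_eq_abs]
  refine tsum_of_norm_bounded (by simpa using (hsum.mul_left ε).hasSum) fun k => ?_
  rw [← mul_sub, norm_mul, Real.norm_of_nonneg (mul_nonneg (hb k) (Real.exp_pos _).le), mul_comm]
  exact mul_le_mul_of_nonneg_right (hfg _ (exp_neg_mem_Icc (by positivity)))
    (mul_nonneg (hb k) (Real.exp_pos _).le)

theorem abs_gammaMean_sub_le {a ε : ℝ} (ha : 0 < a) {f g : ℝ → ℝ}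
    (hf : ContinuousOn f (Set.Icc 0 1)) (hg : ContinuousOn g (Set.Icc 0 1))
    (hfg : ∀ x ∈ Set.Icc (0 : ℝ) 1, |f x - g x| ≤ ε) :
    |gammaMean a f - gammaMean a g| ≤ ε * Real.Gamma a := by
  rw [← gammaMean_one a ha]
  simp only [gammaMean]
  rw [← integral_sub (integrableOn_gammaMean ha hf) (integrableOn_gammaMean ha hg),
    ← integral_const_mul, ← Real.norm_eq_abs]
  refine norm_integral_le_of_norm_le
    (((integrableOn_rpow_mul_exp_neg ha).mul_const 1).const_mul ε) ?_
  refine ae_restrict_of_forall_mem measurableSet_Ioi fun t ht => ?_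
  have ht' : 0 < t := ht
  have h0 : 0 ≤ t ^ (a - 1) * Real.exp (-t) := by positivity
  rw [← mul_sub, norm_mul, Real.norm_of_nonneg h0, mul_comm, mul_one]
  exact mul_le_mul_of_nonneg_right (hfg _ (exp_neg_mem_Icc ht'.le)) h0

theorem tendsto_abelMean_of_continuousOn {b : ℕ → ℝ} (hb : ∀ k, 0 ≤ b k) {a C : ℝ} (ha : 0 < a)
    (hsum : ∀ s : ℝ, 0 < s → Summable fun k : ℕ => b k * Real.exp (-(s * k)))
    (hlim : Filter.Tendsto (abelMean b a fun _ => 1) (nhdsWithin 0 (Set.Ioi 0))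
      (nhds (C * Real.Gamma a))) {g : ℝ → ℝ} (hg : ContinuousOn g (Set.Icc 0 1)) :
    Filter.Tendsto (abelMean b a g) (nhdsWithin 0 (Set.Ioi 0))
      (nhds (C * gammaMean a g)) := by
  rw [Metric.tendsto_nhds]
  intro ε hε
  set L := C * Real.Gamma a with hL
  -- Eventually the mean of `1` is below `|L| + 1`, so replacing `g` by the polynomial costs at most
  -- `ε / 4` both in the mean and in the limit.
  set δ := ε / (4 * (|L| + 1)) with hδ
  have hL0 := abs_nonneg L
  have hδ0 : 0 < δ := by positivity
  have hδ1 : δ * (|L| + 1) = ε / 4 := by rw [hδ]; field_simp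
  obtain ⟨p, hp⟩ := exists_polynomial_near_of_continuousOn 0 1 g hg δ hδ0
  have hpg : ∀ x ∈ Set.Icc (0 : ℝ) 1, |g x - p.eval x| ≤ δ := fun x hx => by
    rw [abs_sub_comm]; exact (hp x hx).le
  have h1 := tendsto_abelMean_polynomial hb ha hsum hlim p
  rw [Metric.tendsto_nhds] at h1
  have h2 := hlim.eventually_lt_const (lt_of_le_of_lt (le_abs_self L) (lt_add_one |L|))
  filter_upwards [h1 (ε / 4) (by positivity), h2, self_mem_nhdsWithin] with s hs1 hs2 hs
  have h3 := abs_abelMean_sub_le (a := a) hb hs (hsum s hs) hg p.continuousOn hpg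
  have h4 : |C * gammaMean a g - C * gammaMean a fun x => p.eval x| ≤ δ * |L| := by
    rw [← mul_sub, abs_mul, hL, abs_mul, abs_of_pos (Real.Gamma_pos_of_pos ha), mul_left_comm]
    exact mul_le_mul_of_nonneg_left (abs_gammaMean_sub_le ha hg p.continuousOn hpg) (abs_nonneg _)
  have h5 : δ * abelMean b a (fun _ => 1) s ≤ ε / 4 := by rw [← hδ1]; gcongr
  have h6 : δ * |L| ≤ ε / 4 := by rw [← hδ1]; gcongr; linarith
  rw [Real.dist_eq] at hs1 ⊢
  rw [abs_le] at h3 h4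
  rw [abs_lt] at hs1 ⊢
  constructor <;> linarith [h3.1, h3.2, h4.1, h4.2, hs1.1, hs1.2]

/-- A continuous function equal to `x⁻¹` for `q ≤ x` and to `0` for `x ≤ p`. -/
noncomputable def invCutoff (p q x : ℝ) : ℝ := min 1 (max 0 ((x - p) / (q - p))) / max x p

theorem continuous_invCutoff {p q : ℝ} (hp : 0 < p) : Continuous (invCutoff p q) := by
  refine Continuous.div (by fun_prop) (by fun_prop) fun x => ?_
  exact (lt_of_lt_of_le hp (le_max_right _ _)).ne'

/-- Both means carry a factor `x = e^{-t}`, which the `x⁻¹` in the cutoff cancels. With the next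
bound, the product is a continuous stand-in for an indicator, to which the limit for continuous
functions applies. -/
theorem indicator_le_mul_invCutoff {p q x : ℝ} (hp : 0 < p) (hpq : p < q) (hx : 0 < x) :
    (Set.Ici q).indicator 1 x ≤ x * invCutoff p q x := by
  by_cases h : q ≤ x
  · rw [Set.indicator_of_mem (by exact h), invCutoff, max_eq_left (by linarith : p ≤ x),
      min_eq_left, mul_one_div_cancel hx.ne']
    · rfl
    · exact le_max_of_le_right ((one_le_div (by linarith)).2 (by linarith))
  · rw [Set.indicator_of_notMem (by exact h), invCutoff]
    have : 0 < max x p := lt_of_lt_of_le hp (le_max_right _ _)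
    positivity

theorem mul_invCutoff_le_indicator {p q x : ℝ} (hpq : p < q) (hx : 0 < x) :
    x * invCutoff p q x ≤ (Set.Ici p).indicator 1 x := by
  by_cases h : p ≤ x
  · rw [Set.indicator_of_mem (by exact h), invCutoff, max_eq_left h, mul_div_cancel₀ _ hx.ne']
    exact min_le_left _ _
  · rw [Set.indicator_of_notMem (by exact h), invCutoff, max_eq_left (a := (0 : ℝ))]
    · simp
    · exact div_nonpos_of_nonpos_of_nonneg (by linarith) (by linarith)

theorem integral_rpow_indicator {a c : ℝ} (ha : 0 < a) (hc : 0 < c) :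
    IntegrableOn (fun t : ℝ => t ^ (a - 1) * (Set.Iic c).indicator 1 t) (Set.Ioi 0) ∧
    ∫ t in Set.Ioi (0 : ℝ), t ^ (a - 1) * (Set.Iic c).indicator 1 t = c ^ a / a := by
  have h : (fun t : ℝ => t ^ (a - 1) * (Set.Iic c).indicator 1 t) =
      (Set.Iic c).indicator fun t : ℝ => t ^ (a - 1) := by
    ext t
    by_cases ht : t ∈ Set.Iic c <;> simp [ht]
  have h2 := intervalIntegral.intervalIntegrable_rpow' (a := 0) (b := c) (r := a - 1)
    (by linarith)
  rw [intervalIntegrable_iff_integrableOn_Ioc_of_le hc.le] at h2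
  rw [h]
  constructor
  · rw [integrableOn_indicator_iff measurableSet_Iic, Set.inter_comm, Set.Ioi_inter_Iic]
    exact h2
  · rw [setIntegral_indicator measurableSet_Iic, Set.Ioi_inter_Iic,
      ← intervalIntegral.integral_of_le hc.le, integral_rpow (Or.inl (by linarith))]
    simp [Real.zero_rpow ha.ne']

theorem indicator_Ici_exp_neg (c t : ℝ) :
    (Set.Ici (Real.exp (-c))).indicator (1 : ℝ → ℝ) (Real.exp (-t)) =
      (Set.Iic c).indicator 1 t := by
  simp [Set.indicator_apply]

theorem gammaMean_invCutoff_mem {a c d : ℝ} (ha : 0 < a) (hd : 0 < d) (hdc : d < c) :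
    gammaMean a (invCutoff (Real.exp (-c)) (Real.exp (-d))) ∈
      Set.Icc (d ^ a / a) (c ^ a / a) := by
  have hlt : Real.exp (-c) < Real.exp (-d) := Real.exp_lt_exp.2 (by linarith)
  have hint := integrableOn_gammaMean ha
    (continuous_invCutoff (q := Real.exp (-d)) (Real.exp_pos (-c))).continuousOn
  rw [← (integral_rpow_indicator ha hd).2, ← (integral_rpow_indicator ha (hd.trans hdc)).2]
  constructor
  · refine setIntegral_mono_on (integral_rpow_indicator ha hd).1 hint measurableSet_Ioi
      fun t ht => ?_
    rw [mul_assoc, ← indicator_Ici_exp_neg]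
    exact mul_le_mul_of_nonneg_left (indicator_le_mul_invCutoff (Real.exp_pos _) hlt
      (Real.exp_pos _)) (Real.rpow_nonneg (le_of_lt ht) _)
  · refine setIntegral_mono_on hint (integral_rpow_indicator ha (hd.trans hdc)).1
      measurableSet_Ioi fun t ht => ?_
    rw [mul_assoc, ← indicator_Ici_exp_neg c]
    exact mul_le_mul_of_nonneg_left (mul_invCutoff_le_indicator hlt
      (Real.exp_pos _)) (Real.rpow_nonneg (le_of_lt ht) _)

/-- At `s = 1 / n` the condition `s k ≤ 1` reads `k ≤ n`, so a sharply truncated Abel sum is a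
partial sum. -/
theorem hasSum_mul_indicator_Iic (b : ℕ → ℝ) {n : ℕ} (hn : 0 < n) :
    HasSum (fun k : ℕ => b k * (Set.Iic (1 : ℝ)).indicator 1 ((n : ℝ)⁻¹ * k))
      (∑ k ∈ Finset.range (n + 1), b k) := by
  have hn' : (0 : ℝ) < n := by exact_mod_cast hn
  have hk : ∀ k : ℕ, (n : ℝ)⁻¹ * k ≤ 1 ↔ k < n + 1 := fun k => by
    rw [inv_mul_le_iff₀ hn', mul_one, Nat.cast_le, Nat.lt_succ_iff]
  have h : HasSum (fun k : ℕ => b k * (Set.Iic (1 : ℝ)).indicator 1 ((n : ℝ)⁻¹ * k)) _ :=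
    hasSum_sum_of_ne_finset_zero (s := Finset.range (n + 1)) fun k h => by
      rw [Finset.mem_range, ← hk] at h
      simp [h]
  convert h using 1
  refine Finset.sum_congr rfl fun k h => ?_
  rw [Finset.mem_range, ← hk] at h
  simp [h]

/-- **Karamata's Tauberian theorem** for power series with nonnegative coefficients. -/
theorem tendsto_sum_div_rpow_of_tendsto_abelMean {b : ℕ → ℝ} (hb : ∀ k, 0 ≤ b k) {a C : ℝ}
    (ha : 0 < a) (hsum : ∀ s : ℝ, 0 < s → Summable fun k : ℕ => b k * Real.exp (-(s * k)))
    (hlim : Filter.Tendsto (fun s : ℝ => s ^ a * ∑' k : ℕ, b k * Real.exp (-(s * k)))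
      (nhdsWithin 0 (Set.Ioi 0)) (nhds C)) :
    Filter.Tendsto (fun n : ℕ => (∑ k ∈ Finset.range (n + 1), b k) / (n : ℝ) ^ a) Filter.atTop
      (nhds (C / Real.Gamma (a + 1))) := by
  have hΓ := Real.Gamma_pos_of_pos ha
  set K := C / Real.Gamma a with hK
  have hlim' : Filter.Tendsto (abelMean b a fun _ => 1) (nhdsWithin 0 (Set.Ioi 0))
      (nhds (K * Real.Gamma a)) := by
    rw [hK, div_mul_cancel₀ _ hΓ.ne']
    refine hlim.congr fun s => ?_
    simp only [abelMean, mul_one]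
  have hC : 0 ≤ C := by
    refine ge_of_tendsto hlim ?_
    filter_upwards [self_mem_nhdsWithin] with s hs
    exact mul_nonneg (Real.rpow_nonneg (le_of_lt hs) _)
      (tsum_nonneg fun k => mul_nonneg (hb k) (Real.exp_pos _).le)
  have hK0 : 0 ≤ K := div_nonneg hC hΓ.le
  have hval : C / Real.Gamma (a + 1) = K * ((1 : ℝ) ^ a / a) := by
    rw [Real.Gamma_add_one ha.ne', hK, Real.one_rpow]; field_simp
  have hinv : Filter.Tendsto (fun n : ℕ => (n : ℝ)⁻¹) Filter.atTop (nhdsWithin 0 (Set.Ioi 0)) :=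
    tendsto_inv_atTop_nhdsGT_zero.comp tendsto_natCast_atTop_atTop
  have hcut : ∀ c d : ℝ, Filter.Tendsto
      (fun n : ℕ => abelMean b a (invCutoff (Real.exp (-c)) (Real.exp (-d))) (n : ℝ)⁻¹)
      Filter.atTop (nhds (K * gammaMean a (invCutoff (Real.exp (-c)) (Real.exp (-d))))) :=
    fun c d => (tendsto_abelMean_of_continuousOn hb ha hsum hlim'
      (continuous_invCutoff (Real.exp_pos _)).continuousOn).comp hinv
  have hcont : ContinuousAt (fun c : ℝ => K * (c ^ a / a)) 1 :=
    continuousAt_const.mul ((Real.continuousAt_rpow_const _ _ (Or.inl one_ne_zero)).div_const _)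
  have hdiv : ∀ n : ℕ, (∑ k ∈ Finset.range (n + 1), b k) / (n : ℝ) ^ a =
      ((n : ℝ)⁻¹) ^ a * ∑ k ∈ Finset.range (n + 1), b k := fun n => by
    rw [Real.inv_rpow (by positivity), div_eq_inv_mul]
  rw [hval, tendsto_order]
  constructor
  · intro y hy
    -- Lower bound: the cutoff descends between `t = d < 1` and `t = 1`, so it stays below the
    -- indicator of `t ≤ 1`; continuity of `c ^ a / a` at `1` lets `d` be chosen close enough.
    have h1 := (hcont.eventually_const_lt hy).filter_mono (nhdsWithin_le_nhds (s := Set.Iio 1))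
    obtain ⟨d, hd, hd1, hd0⟩ := (h1.and (Ioo_mem_nhdsLT (zero_lt_one' ℝ))).exists
    have hlt : Real.exp (-1) < Real.exp (-d) := Real.exp_lt_exp.2 (by linarith)
    have h2 : y < K * gammaMean a (invCutoff (Real.exp (-1)) (Real.exp (-d))) :=
      hd.trans_le (mul_le_mul_of_nonneg_left (gammaMean_invCutoff_mem ha hd1 hd0).1 hK0)
    filter_upwards [(hcut 1 d).eventually_const_lt h2, Filter.eventually_gt_atTop 0] with n hn hn0
    refine hn.trans_le ?_
    have hn' : (0 : ℝ) < (n : ℝ)⁻¹ := by positivity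
    rw [hdiv, abelMean]
    refine mul_le_mul_of_nonneg_left ?_ (by positivity)
    have hs := hasSum_mul_indicator_Iic b hn0
    rw [← hs.tsum_eq]
    refine Summable.tsum_le_tsum (fun k => ?_) (summable_mul_comp_exp hb hn' (hsum _ hn')
      (continuous_invCutoff (Real.exp_pos _)).continuousOn) hs.summable
    rw [mul_assoc, ← indicator_Ici_exp_neg]
    exact mul_le_mul_of_nonneg_left
      (mul_invCutoff_le_indicator hlt (Real.exp_pos _)) (hb k)
  · intro y hy
    -- Upper bound: the cutoff now descends between `t = 1` and `t = c > 1`, above the indicator of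
    -- `t ≤ 1`.
    have h1 := (hcont.eventually_lt_const hy).filter_mono (nhdsWithin_le_nhds (s := Set.Ioi 1))
    obtain ⟨c, hc, hc1⟩ := (h1.and self_mem_nhdsWithin).exists
    have hc1' : (1 : ℝ) < c := hc1
    have hlt : Real.exp (-c) < Real.exp (-1) := Real.exp_lt_exp.2 (by linarith)
    have h2 : K * gammaMean a (invCutoff (Real.exp (-c)) (Real.exp (-1))) < y :=
      (mul_le_mul_of_nonneg_left (gammaMean_invCutoff_mem ha one_pos hc1').2 hK0).trans_lt hc
    filter_upwards [(hcut c 1).eventually_lt_const h2, Filter.eventually_gt_atTop 0] with n hn hn0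
    refine lt_of_le_of_lt ?_ hn
    have hn' : (0 : ℝ) < (n : ℝ)⁻¹ := by positivity
    rw [hdiv, abelMean]
    refine mul_le_mul_of_nonneg_left ?_ (by positivity)
    have hs := hasSum_mul_indicator_Iic b hn0
    rw [← hs.tsum_eq]
    refine Summable.tsum_le_tsum (fun k => ?_) hs.summable (summable_mul_comp_exp hb hn'
      (hsum _ hn') (continuous_invCutoff (Real.exp_pos _)).continuousOn)
    rw [mul_assoc, ← indicator_Ici_exp_neg]
    exact mul_le_mul_of_nonneg_left
      (indicator_le_mul_invCutoff (Real.exp_pos _) hlt (Real.exp_pos _)) (hb k)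

/-! ### The sum of `1 / cosh (t h)` for small `t` -/

/-- An antiderivative is `arctan (sinh (t x)) / t`. -/
theorem integral_Ioi_inv_cosh {t : ℝ} (ht : 0 < t) :
    IntegrableOn (fun x => (Real.cosh (t * x))⁻¹) (Set.Ioi 0) ∧
    ∫ x in Set.Ioi (0 : ℝ), (Real.cosh (t * x))⁻¹ = Real.pi / 2 / t := by
  have hd : ∀ x ∈ Set.Ici (0 : ℝ), HasDerivAt (fun x => Real.arctan (Real.sinh (t * x)) / t)
      (Real.cosh (t * x))⁻¹ x := fun x _ => by
    have h := ((((hasDerivAt_id x).const_mul t).sinh).arctan).div_const t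
    refine h.congr_deriv ?_
    have h1 := Real.cosh_sq (t * x)
    have h2 := Real.cosh_pos (t * x)
    rw [id, add_comm (1 : ℝ), ← h1]
    field_simp
  have hp : ∀ x ∈ Set.Ioi (0 : ℝ), 0 ≤ (Real.cosh (t * x))⁻¹ :=
    fun x _ => inv_nonneg.2 (Real.cosh_pos _).le
  have hsinh : Filter.Tendsto Real.sinh Filter.atTop Filter.atTop :=
    Filter.tendsto_atTop_mono' _ (by
      filter_upwards [Filter.eventually_ge_atTop 0] with x hx
      exact Real.self_le_sinh_iff.2 hx) Filter.tendsto_id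
  have hl : Filter.Tendsto (fun x => Real.arctan (Real.sinh (t * x)) / t) Filter.atTop
      (nhds (Real.pi / 2 / t)) :=
    (((Real.tendsto_arctan_atTop.mono_right nhdsWithin_le_nhds).comp hsinh).comp
      (Filter.tendsto_id.const_mul_atTop ht)).div_const t
  refine ⟨integrableOn_Ioi_deriv_of_nonneg' hd hp hl, ?_⟩
  rw [integral_Ioi_of_hasDerivAt_of_nonneg' hd hp hl]
  simp

theorem antitoneOn_inv_cosh {t : ℝ} (ht : 0 < t) :
    AntitoneOn (fun x => (Real.cosh (t * x))⁻¹) (Set.Ici 0) := by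
  intro x hx y hy hxy
  have hx' : (0 : ℝ) ≤ x := hx
  have hy' : (0 : ℝ) ≤ y := hy
  refine inv_anti₀ (Real.cosh_pos _) (Real.cosh_le_cosh.2 ?_)
  rw [abs_of_nonneg (by positivity), abs_of_nonneg (by positivity)]
  gcongr

theorem summable_inv_cosh {t : ℝ} (ht : 0 < t) :
    Summable fun h : ℕ => (Real.cosh (t * h))⁻¹ :=
  (antitoneOn_inv_cosh ht).summable_of_integrableOn_Ioi_zero (integral_Ioi_inv_cosh ht).1
    fun _ _ => inv_nonneg.2 (Real.cosh_pos _).le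

/-- The summand decreases in `h`, so sum and integral differ by at most the omitted term `h = 0`,
which is `1` and contributes `t → 0` after scaling. -/
theorem tendsto_mul_tsum_inv_cosh :
    Filter.Tendsto (fun t : ℝ => t * ∑' h : ℕ, (Real.cosh (t * (h + 1 : ℕ)))⁻¹)
      (nhdsWithin 0 (Set.Ioi 0)) (nhds (Real.pi / 2)) := by
  have h0 : Filter.Tendsto (fun t : ℝ => Real.pi / 2 - t) (nhdsWithin 0 (Set.Ioi 0))
      (nhds (Real.pi / 2)) :=
    (Continuous.tendsto' (by fun_prop) _ _ (by simp)).mono_left nhdsWithin_le_nhds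
  refine tendsto_of_tendsto_of_tendsto_of_le_of_le' h0 tendsto_const_nhds ?_ ?_
  · filter_upwards [self_mem_nhdsWithin] with t (ht : 0 < t)
    have h1 := (antitoneOn_inv_cosh ht).integral_le_tsum (summable_inv_cosh ht)
      fun _ _ => inv_nonneg.2 (Real.cosh_pos _).le
    rw [(integral_Ioi_inv_cosh ht).2, (summable_inv_cosh ht).tsum_eq_zero_add,
      div_le_iff₀ ht] at h1
    simp only [Nat.cast_zero, mul_zero, Real.cosh_zero, inv_one] at h1
    linarith
  · filter_upwards [self_mem_nhdsWithin] with t (ht : 0 < t)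
    have h1 := (antitoneOn_inv_cosh ht).tsum_add_one_le_integral (integral_Ioi_inv_cosh ht).1
      fun _ _ => inv_nonneg.2 (Real.cosh_pos _).le
    rw [(integral_Ioi_inv_cosh ht).2, le_div_iff₀ ht] at h1
    linarith

/-! ### The angle as a function of the generating-function variable -/

/-- The positive angle `t` with `z = 2 cosh t / (1 + cosh² t)`. -/
noncomputable def combAngle (z : ℝ) : ℝ := Real.arcosh ((1 + √(1 - z ^ 2)) / z)

theorem one_lt_combAngle_arg {z : ℝ} (hz : 0 < z) (hz1 : z < 1) :
    1 < (1 + √(1 - z ^ 2)) / z := by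
  rw [one_lt_div hz]
  linarith [Real.sqrt_nonneg (1 - z ^ 2)]

theorem combAngle_pos {z : ℝ} (hz : 0 < z) (hz1 : z < 1) : 0 < combAngle z :=
  Real.arcosh_pos (one_lt_combAngle_arg hz hz1)

/-- The number `cosh t` is the larger root of `z c² - 2 c + z = 0`, the one exceeding `1`. -/
theorem mul_one_add_cosh_combAngle_sq {z : ℝ} (hz : 0 < z) (hz1 : z < 1) :
    z * (1 + Real.cosh (combAngle z) ^ 2) = 2 * Real.cosh (combAngle z) := by
  rw [combAngle, Real.cosh_arcosh (one_lt_combAngle_arg hz hz1).le]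
  have h := Real.sq_sqrt (show 0 ≤ 1 - z ^ 2 by nlinarith)
  field_simp
  linear_combination h

theorem tendsto_combAngle_exp_neg :
    Filter.Tendsto (fun s : ℝ => combAngle (Real.exp (-s))) (nhdsWithin 0 (Set.Ioi 0))
      (nhdsWithin 0 (Set.Ioi 0)) := by
  refine tendsto_nhdsWithin_iff.2 ⟨?_, ?_⟩
  · have h1 : ContinuousWithinAt Real.arcosh (Set.Ici 1) 1 :=
      Real.continuousOn_arcosh 1 Set.self_mem_Ici
    have h2 : Filter.Tendsto (fun s : ℝ => (1 + √(1 - Real.exp (-s) ^ 2)) / Real.exp (-s))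
        (nhdsWithin 0 (Set.Ioi 0)) (nhdsWithin 1 (Set.Ici 1)) := by
      refine tendsto_nhdsWithin_iff.2 ⟨?_, ?_⟩
      · refine Filter.Tendsto.mono_left ?_ nhdsWithin_le_nhds
        refine Continuous.tendsto' ?_ _ _ (by simp)
        exact Continuous.div (by fun_prop) (by fun_prop) fun _ => (Real.exp_pos _).ne'
      · filter_upwards [self_mem_nhdsWithin] with s (hs : 0 < s)
        exact (one_lt_combAngle_arg (Real.exp_pos _) (Real.exp_lt_one_iff.2 (by linarith))).le
    have h3 := h1.tendsto.comp h2
    rwa [Real.arcosh_zero] at h3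
  · filter_upwards [self_mem_nhdsWithin] with s (hs : 0 < s)
    exact combAngle_pos (Real.exp_pos _) (Real.exp_lt_one_iff.2 (by linarith))

/-- Since `cosh t - 1 = 2 sinh² (t / 2)`, only the derivative of `sinh` at `0` is needed. -/
theorem tendsto_cosh_sub_one_div_sq :
    Filter.Tendsto (fun t : ℝ => (Real.cosh t - 1) / t ^ 2) (nhdsWithin 0 (Set.Ioi 0))
      (nhds (1 / 2)) := by
  have h := (Real.hasDerivAt_sinh 0).tendsto_slope_zero_right
  have h2 : Filter.Tendsto (fun t : ℝ => t / 2) (nhdsWithin 0 (Set.Ioi 0))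
      (nhdsWithin 0 (Set.Ioi 0)) := by
    refine tendsto_nhdsWithin_iff.2 ⟨?_, ?_⟩
    · exact (Continuous.tendsto' (by fun_prop) _ _ (by simp)).mono_left nhdsWithin_le_nhds
    · filter_upwards [self_mem_nhdsWithin] with s (hs : 0 < s)
      exact half_pos hs
  have h3 := ((h.comp h2).pow 2).div_const 2
  rw [Real.cosh_zero, one_pow] at h3
  refine h3.congr' ?_
  filter_upwards [self_mem_nhdsWithin] with t (ht : 0 < t)
  have h4 := Real.cosh_two_mul (t / 2)
  rw [mul_div_cancel₀ t two_ne_zero, Real.cosh_sq] at h4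
  simp only [Function.comp, zero_add, Real.sinh_zero, sub_zero, smul_eq_mul]
  rw [h4]
  field_simp
  ring

/-- The relation between `z` and `t` rearranges to `(cosh t - 1)² = (1 - z) (1 + cosh² t)`. The left
side is asymptotic to `t⁴ / 4`, the last factor tends to `2`, and `1 - e^{-s} ~ s`. -/
theorem tendsto_div_combAngle_pow_four :
    Filter.Tendsto (fun s : ℝ => s / combAngle (Real.exp (-s)) ^ 4) (nhdsWithin 0 (Set.Ioi 0))
      (nhds (1 / 8)) := by
  have h1 : Filter.Tendsto (fun t : ℝ => ((Real.cosh t - 1) / t ^ 2) ^ 2 / (1 + Real.cosh t ^ 2))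
      (nhdsWithin 0 (Set.Ioi 0)) (nhds (1 / 8)) := by
    have h : Filter.Tendsto (fun t : ℝ => 1 + Real.cosh t ^ 2) (nhdsWithin 0 (Set.Ioi 0))
        (nhds 2) :=
      (Continuous.tendsto' (by fun_prop) _ _ (by norm_num)).mono_left nhdsWithin_le_nhds
    rw [show (1 / 8 : ℝ) = (1 / 2) ^ 2 / 2 by norm_num]
    exact (tendsto_cosh_sub_one_div_sq.pow 2).div h two_ne_zero
  have h2 := ((Real.hasDerivAt_exp (-0)).comp 0 (hasDerivAt_neg (0 : ℝ))).tendsto_slope_zero_right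
  simp only [Function.comp, zero_add, neg_zero, Real.exp_zero, smul_eq_mul] at h2
  have h3 := (h1.comp tendsto_combAngle_exp_neg).mul (h2.neg.inv₀ (by norm_num))
  norm_num at h3
  refine h3.congr' ?_
  filter_upwards [self_mem_nhdsWithin] with s (hs : 0 < s)
  have hz1 : Real.exp (-s) < 1 := Real.exp_lt_one_iff.2 (by linarith)
  have h4 := mul_one_add_cosh_combAngle_sq (Real.exp_pos (-s)) hz1
  have h5 := combAngle_pos (Real.exp_pos (-s)) hz1
  have h6 : (Real.cosh (combAngle (Real.exp (-s))) - 1) ^ 2 =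
      (1 - Real.exp (-s)) * (1 + Real.cosh (combAngle (Real.exp (-s))) ^ 2) := by
    linear_combination h4
  have h7 : 1 - Real.exp (-s) ≠ 0 := by linarith
  have h8 : Real.exp (-s) - 1 ≠ 0 := by linarith
  rw [div_pow, h6]
  field_simp
  ring

theorem tendsto_rpow_mul_tsum_inv_cosh :
    Filter.Tendsto (fun s : ℝ => s ^ (1 / 4 : ℝ) *
      ∑' h : ℕ, (Real.cosh (combAngle (Real.exp (-s)) * (h + 1 : ℕ)))⁻¹)
      (nhdsWithin 0 (Set.Ioi 0)) (nhds ((1 / 8 : ℝ) ^ (1 / 4 : ℝ) * (Real.pi / 2))) := by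
  have h1 := tendsto_div_combAngle_pow_four.rpow_const (p := 1 / 4) (Or.inl (by norm_num))
  refine (h1.mul (tendsto_mul_tsum_inv_cosh.comp tendsto_combAngle_exp_neg)).congr' ?_
  filter_upwards [self_mem_nhdsWithin] with s (hs : 0 < s)
  have ht := combAngle_pos (Real.exp_pos (-s)) (Real.exp_lt_one_iff.2 (by linarith))
  have h4 : (combAngle (Real.exp (-s)) ^ 4) ^ (1 / 4 : ℝ) = combAngle (Real.exp (-s)) := by
    rw [← Real.rpow_natCast, ← Real.rpow_mul ht.le]
    norm_num
  rw [Real.div_rpow hs.le (by positivity), h4, Function.comp, ← mul_assoc, div_mul_cancel₀ _ ht.ne']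

/-! ### The Markov property in integrated form -/

namespace IsSimpleRandomWalk

variable {V : Type*} [MeasurableSpace V]
  {Ω : Type*} [MeasurableSpace Ω] {μ : Measure Ω} [IsProbabilityMeasure μ]
  {G : SimpleGraph V} {o : V} {S : ℕ → Ω → V}

theorem measure_path_eq (hS : IsSimpleRandomWalk G o μ S) (n : ℕ) (x : Fin (n + 1) → V) (q : V) :
    μ {ω | (∀ i : Fin (n + 1), S i ω = x i) ∧ S (n + 1) ω = q} =
      μ {ω | ∀ i : Fin (n + 1), S i ω = x i} *
        ENNReal.ofReal (srwTransition G (x (Fin.last n)) q) := by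
  -- Only the values up to `n + 1` matter; all later ones are set to `q` as well.
  let y : ℕ → V := fun i => if h : i < n + 1 then x ⟨i, h⟩ else q
  have hy : ∀ i : Fin (n + 1), y i = x i := fun i => dif_pos i.2
  have h1 : {ω | ∀ i ≤ n, S i ω = y i} = {ω | ∀ i : Fin (n + 1), S i ω = x i} := by
    ext ω
    simp only [Set.mem_ofPred_eq, ← hy]
    exact ⟨fun h i => h i (Nat.lt_succ_iff.1 i.2), fun h i hi => h ⟨i, Nat.lt_succ_iff.2 hi⟩⟩
  have h2 : {ω | ∀ i ≤ n + 1, S i ω = y i} =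
      {ω | (∀ i : Fin (n + 1), S i ω = x i) ∧ S (n + 1) ω = q} := by
    ext ω
    have h3 : ω ∈ {ω | ∀ i : Fin (n + 1), S i ω = x i} ↔ ∀ i ≤ n, S i ω = y i := by
      rw [← h1]; rfl
    have hq : y (n + 1) = q := by simp [y]
    refine ⟨fun h => ⟨h3.2 fun i hi => h i (by omega), hq ▸ h (n + 1) le_rfl⟩, fun h i hi => ?_⟩
    rcases Nat.lt_or_eq_of_le hi with hi | rfl
    · exact h3.1 h.1 i (by omega)
    · rw [hq]; exact h.2
  have h := hS.step n y
  rw [h1, h2] at h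
  have hl : y n = x (Fin.last n) := hy (Fin.last n)
  have hq : y (n + 1) = q := by simp [y]
  rw [hl, hq] at h
  rw [← ENNReal.ofReal_toReal (measure_ne_top μ {ω | (∀ i : Fin (n + 1), S i ω = x i) ∧ _}),
    ← measureReal_def, h, ENNReal.ofReal_mul measureReal_nonneg, measureReal_def,
    ENNReal.ofReal_toReal (measure_ne_top μ _)]

/-- There are countably many paths of length `n`, so both integrals are sums over paths, and the
rule for path probabilities matches them term by term. The event restricts only the past and factors
out. -/
theorem setLIntegral_succ [MeasurableSingletonClass V] [Countable V]
    (hS : IsSimpleRandomWalk G o μ S) (n : ℕ) (B : Set V)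
    (g : V → ENNReal) :
    ∫⁻ ω in {ω | ∀ i ≤ n, S i ω ∈ B}, g (S (n + 1) ω) ∂μ =
      ∫⁻ ω in {ω | ∀ i ≤ n, S i ω ∈ B},
        ∑' q, ENNReal.ofReal (srwTransition G (S n ω) q) * g q ∂μ := by
  have hset : {ω | ∀ i ≤ n, S i ω ∈ B} =
      (fun ω (i : Fin (n + 1)) => S i ω) ⁻¹' {x | ∀ i, x i ∈ B} := by
    ext ω
    exact ⟨fun h i => h i (Nat.lt_succ_iff.1 i.2), fun h i hi => h ⟨i, Nat.lt_succ_iff.2 hi⟩⟩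
  have hX : Measurable fun ω (i : Fin (n + 1)) => S i ω :=
    measurable_pi_lambda _ fun i => hS.measurable i
  have hZ : Measurable fun ω => ((fun i : Fin (n + 1) => S i ω), S (n + 1) ω) :=
    hX.prodMk (hS.measurable _)
  have hB : MeasurableSet {x : Fin (n + 1) → V | ∀ i, x i ∈ B} := MeasurableSet.of_discrete
  have key1 : ∫⁻ ω, ({x : Fin (n + 1) → V | ∀ i, x i ∈ B}.indicator 1 fun i => S i ω) *
      g (S (n + 1) ω) ∂μ = ∑' x : Fin (n + 1) → V, ∑' q : V,
        {x : Fin (n + 1) → V | ∀ i, x i ∈ B}.indicator 1 x * g q *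
        (μ {ω | ∀ i : Fin (n + 1), S i ω = x i} *
        ENNReal.ofReal (srwTransition G (x (Fin.last n)) q)) := by
    rw [← ENNReal.tsum_prod, ← lintegral_map (f := fun z : (Fin (n + 1) → V) × V =>
      {x : Fin (n + 1) → V | ∀ i, x i ∈ B}.indicator 1 z.1 * g z.2) (measurable_of_countable _) hZ,
      lintegral_countable']
    refine tsum_congr fun z => ?_
    rw [← measure_path_eq hS, Measure.map_apply hZ (measurableSet_singleton _)]
    congr 2
    ext ω
    simp [Prod.ext_iff, funext_iff]
  have key2 : ∫⁻ ω, ({x : Fin (n + 1) → V | ∀ i, x i ∈ B}.indicator 1 fun i => S i ω) *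
      ∑' q, ENNReal.ofReal (srwTransition G (S n ω) q) * g q ∂μ = ∑' x : Fin (n + 1) → V,
        ({x : Fin (n + 1) → V | ∀ i, x i ∈ B}.indicator 1 x *
        ∑' q, ENNReal.ofReal (srwTransition G (x (Fin.last n)) q) * g q) *
        μ {ω | ∀ i : Fin (n + 1), S i ω = x i} := by
    refine (lintegral_map (f := fun x : Fin (n + 1) → V =>
      {x : Fin (n + 1) → V | ∀ i, x i ∈ B}.indicator 1 x *
        ∑' q, ENNReal.ofReal (srwTransition G (x (Fin.last n)) q) * g q)
        (measurable_of_countable _) hX).symm.trans ?_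
    rw [lintegral_countable']
    refine tsum_congr fun z => ?_
    rw [Measure.map_apply hX (measurableSet_singleton _)]
    congr 2
    ext ω
    simp [funext_iff]
  have hind : ∀ f : Ω → ENNReal, ∫⁻ ω in {ω | ∀ i ≤ n, S i ω ∈ B}, f ω ∂μ =
      ∫⁻ ω, ({x : Fin (n + 1) → V | ∀ i, x i ∈ B}.indicator 1 fun i => S i ω) * f ω ∂μ := by
    intro f
    rw [← lintegral_indicator (hset ▸ hX hB)]
    congr 1
    ext ω
    classical
    rw [hset, Set.indicator_apply, Set.indicator_apply, Set.mem_preimage]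
    split_ifs <;> simp
  rw [hind, hind, key1, key2]
  refine tsum_congr fun x => ?_
  rw [mul_assoc, ← ENNReal.tsum_mul_right, ← ENNReal.tsum_mul_left]
  exact tsum_congr fun q => by ring

end IsSimpleRandomWalk

theorem tsum_srwTransition_combGraph (p : ℤ × ℤ) (g : ℤ × ℤ → ENNReal) :
    ∑' q, ENNReal.ofReal (srwTransition combGraph p q) * g q =
      (∑ u, g (combStep p u)) / 4 := by
  classical
  have h : ∀ q, ENNReal.ofReal (srwTransition combGraph p q) * g q =
      ∑ u, (if q = combStep p u then g q / 4 else 0) := by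
    intro q
    rw [← combStep_count, ENNReal.ofReal_div_of_pos (by norm_num), ENNReal.ofReal_natCast,
      ← Finset.sum_filter, Finset.sum_const, nsmul_eq_mul]
    simp only [eq_comm (a := q)]
    rw [ENNReal.ofReal_ofNat, div_eq_mul_inv, div_eq_mul_inv]
    ring
  rw [tsum_congr h, Summable.tsum_finsetSum fun _ _ => ENNReal.summable]
  simp only [tsum_ite_eq]
  rw [div_eq_mul_inv, Finset.sum_mul]
  rfl

theorem setLIntegral_combGraph_succ {Ω : Type*} [MeasurableSpace Ω] {μ : Measure Ω}
    [IsProbabilityMeasure μ] {S : ℕ → Ω → ℤ × ℤ} {o : ℤ × ℤ}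
    (hS : IsSimpleRandomWalk combGraph o μ S) (n : ℕ) (B : Set (ℤ × ℤ)) (g : ℤ × ℤ → ENNReal) :
    ∫⁻ ω in {ω | ∀ i ≤ n, S i ω ∈ B}, g (S (n + 1) ω) ∂μ =
      ∫⁻ ω in {ω | ∀ i ≤ n, S i ω ∈ B}, (∑ u, g (combStep (S n ω) u)) / 4 ∂μ := by
  simp only [hS.setLIntegral_succ, tsum_srwTransition_combGraph]

theorem abs_combStep_fst_le (p : ℤ × ℤ) (u : Fin 4) : |(combStep p u).1| ≤ |p.1| + 1 := by
  unfold combStep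
  split_ifs <;> grind

/-- Path probabilities determine the steps only almost surely: inductively, the indicator of a
violation at time `n + 1` has zero one-step average on almost every past. -/
theorem ae_abs_fst_le {Ω : Type*} [MeasurableSpace Ω] {μ : Measure Ω}
    [IsProbabilityMeasure μ] {S : ℕ → Ω → ℤ × ℤ} (hS : IsSimpleRandomWalk combGraph (0, 0) μ S)
    (n : ℕ) : ∀ᵐ ω ∂μ, |(S n ω).1| ≤ n := by
  induction n with
  | zero => filter_upwards [hS.start] with ω h; simp [h]
  | succ n ih =>
    have h := setLIntegral_combGraph_succ hS n Set.univ
      ({p | ¬ |p.1| ≤ ((n + 1 : ℕ) : ℤ)}.indicator 1)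
    have h2 : ∫⁻ ω in {ω | ∀ i ≤ n, S i ω ∈ Set.univ},
        (∑ u, ({p | ¬ |p.1| ≤ ((n + 1 : ℕ) : ℤ)}.indicator 1 (combStep (S n ω) u) : ENNReal)) / 4
        ∂μ = 0 := by
      refine lintegral_eq_zero_of_ae_eq_zero (ae_restrict_of_ae ?_)
      filter_upwards [ih] with ω hω
      rw [Finset.sum_eq_zero fun u _ => ?_]
      · simp
      · have := abs_combStep_fst_le (S n ω) u
        exact Set.indicator_of_notMem (by
          simp only [Set.mem_ofPred_eq, not_not]; push_cast; omega) _
    rw [h2] at h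
    simp only [Set.mem_univ, implies_true, Set.ofPred_true, Measure.restrict_univ] at h
    have hm : Measurable fun ω => ({p : ℤ × ℤ | ¬ |p.1| ≤ ((n + 1 : ℕ) : ℤ)}.indicator 1
        (S (n + 1) ω) : ENNReal) :=
      (measurable_of_countable (Set.indicator _ _)).comp (hS.measurable _)
    filter_upwards [(lintegral_eq_zero_iff hm).1 h] with ω hω
    by_contra hc
    push_cast at hc
    simp [hc] at hω

/-! ### The harmonic function of the strip -/

/-- The function that is harmonic up to the factor `z = 2 cosh t / (1 + cosh² t)` inside the strip
`|x| < h`, and equal to its boundary value `cosh (t h)` outside. -/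
noncomputable def combHarmonic (t : ℝ) (h : ℕ) (p : ℤ × ℤ) : ℝ :=
  if |p.1| < h then Real.cosh (t * p.1) * (Real.cosh t)⁻¹ ^ p.2.natAbs else Real.cosh (t * h)

theorem combHarmonic_nonneg (t : ℝ) (h : ℕ) (p : ℤ × ℤ) : 0 ≤ combHarmonic t h p := by
  have h1 := Real.cosh_pos t
  have h2 := Real.cosh_pos (t * p.1)
  have h3 := Real.cosh_pos (t * h)
  unfold combHarmonic
  split_ifs <;> positivity

theorem combHarmonic_le (t : ℝ) (h : ℕ) (p : ℤ × ℤ) :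
    combHarmonic t h p ≤ Real.cosh (t * h) := by
  unfold combHarmonic
  split_ifs with hp
  · have h1 : Real.cosh (t * p.1) ≤ Real.cosh (t * h) := by
      rw [Real.cosh_le_cosh, abs_mul, abs_mul]
      refine mul_le_mul_of_nonneg_left ?_ (abs_nonneg t)
      rw [Nat.abs_cast]
      exact_mod_cast hp.le
    have h2 : (Real.cosh t)⁻¹ ^ p.2.natAbs ≤ 1 :=
      pow_le_one₀ (inv_nonneg.2 (Real.cosh_pos t).le) (inv_le_one_of_one_le₀ (Real.one_le_cosh t))
    exact (mul_le_of_le_one_right (Real.cosh_pos _).le h2).trans h1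
  · exact le_rfl

/-- The interior formula and the boundary value agree at `|x| = h`, so a step along the axis needs
no separate treatment when it exits. -/
theorem combHarmonic_axis {t : ℝ} {h : ℕ} {x : ℤ} (hx : |x| ≤ h) :
    combHarmonic t h (x, 0) = Real.cosh (t * x) := by
  unfold combHarmonic
  rcases hx.lt_or_eq with hx | hx
  · simp [hx]
  · simp only [hx, lt_irrefl, if_false]
    rw [← Real.cosh_abs (t * x), abs_mul, ← Int.cast_abs, hx, ← Real.cosh_abs (t * h), abs_mul,
      Nat.abs_cast]
    simp

theorem combHarmonic_strip {t : ℝ} {h : ℕ} {x : ℤ} (hx : |x| < h) (y : ℤ) :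
    combHarmonic t h (x, y) = Real.cosh (t * x) * (Real.cosh t)⁻¹ ^ y.natAbs :=
  if_pos hx

theorem pow_natAbs_add_one_add_sub_one (r : ℝ) {y : ℤ} (hy : y ≠ 0) :
    r * (r ^ (y + 1).natAbs + r ^ (y - 1).natAbs) = (1 + r ^ 2) * r ^ y.natAbs := by
  obtain ⟨n, rfl | rfl⟩ := y.eq_nat_or_neg
  · obtain ⟨m, rfl⟩ : ∃ m, n = m + 1 := ⟨n - 1, by omega⟩
    rw [show (((m + 1 : ℕ) : ℤ) + 1).natAbs = m + 2 by omega,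
      show (((m + 1 : ℕ) : ℤ) - 1).natAbs = m by omega, Int.natAbs_natCast]
    ring
  · obtain ⟨m, rfl⟩ : ∃ m, n = m + 1 := ⟨n - 1, by omega⟩
    rw [show (-((m + 1 : ℕ) : ℤ) + 1).natAbs = m by omega,
      show (-((m + 1 : ℕ) : ℤ) - 1).natAbs = m + 2 by omega,
      show (-((m + 1 : ℕ) : ℤ)).natAbs = m + 1 by omega]
    ring

/-- With `r = 1 / cosh t`, a vertical step off the axis multiplies by `(r + 1 / r) / 2`. On the axis
the two vertical moves give `r` each and the two horizontal ones average to `cosh t = 1 / r`, so the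
factor is the same, namely `1 / z`. -/
theorem sum_combHarmonic_combStep {t z : ℝ} (hz : z * (1 + Real.cosh t ^ 2) = 2 * Real.cosh t)
    {h : ℕ} {p : ℤ × ℤ} (hp : |p.1| < h) :
    z * ((∑ u, combHarmonic t h (combStep p u)) / 4) = combHarmonic t h p := by
  obtain ⟨x, y⟩ := p
  have hp : |x| < h := hp
  have hc := Real.cosh_pos t
  rw [Fin.sum_univ_four]
  by_cases hy : y = 0
  · subst hy
    have e0 : combStep (x, 0) 0 = (x, 1) := rfl
    have e1 : combStep (x, 0) 1 = (x, -1) := rfl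
    have e2 : combStep (x, 0) 2 = (x + 1, 0) := rfl
    have e3 : combStep (x, 0) 3 = (x - 1, 0) := rfl
    rw [e0, e1, e2, e3, combHarmonic_strip hp, combHarmonic_strip hp,
      combHarmonic_axis (by grind), combHarmonic_axis (by grind), combHarmonic_axis hp.le]
    push_cast
    rw [mul_add, mul_sub, mul_one, Real.cosh_add, Real.cosh_sub]
    rw [pow_one]
    field_simp
    linear_combination 2 * Real.cosh (t * x) * hz
  · have e0 : combStep (x, y) 0 = (x, y + 1) := rfl
    have e1 : combStep (x, y) 1 = (x, y - 1) := rfl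
    have e2 : combStep (x, y) 2 = (x, y + 1) := by simp [combStep, hy]
    have e3 : combStep (x, y) 3 = (x, y - 1) := by simp [combStep, hy]
    rw [e0, e1, e2, e3, combHarmonic_strip hp, combHarmonic_strip hp, combHarmonic_strip hp]
    have h1 := pow_natAbs_add_one_add_sub_one (Real.cosh t)⁻¹ hy
    set a := (Real.cosh t)⁻¹ ^ (y + 1).natAbs
    set b := (Real.cosh t)⁻¹ ^ (y - 1).natAbs
    set d := (Real.cosh t)⁻¹ ^ y.natAbs
    have h2 : Real.cosh t * (a + b) = (1 + Real.cosh t ^ 2) * d := by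
      field_simp at h1
      linear_combination h1
    have h3 : 2 * Real.cosh t * (z * (a + b)) = 2 * Real.cosh t * (2 * d) := by
      linear_combination 2 * z * h2 + 2 * d * hz
    have h4 := mul_left_cancel₀ (by positivity) h3
    linear_combination Real.cosh (t * x) / 2 * h4

/-! ### Exit times and the expected deviation -/

section Walk

variable {Ω : Type*} {S : ℕ → Ω → ℤ × ℤ}

/-- The event that the first coordinate stays in `(-h, h)` up to time `n`. -/
def stripEvent (S : ℕ → Ω → ℤ × ℤ) (h n : ℕ) : Set Ω :=
  {ω | ∀ i ≤ n, S i ω ∈ {p : ℤ × ℤ | |p.1| < h}}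

theorem stripEvent_succ (h n : ℕ) :
    stripEvent S h (n + 1) = stripEvent S h n ∩ {ω | |(S (n + 1) ω).1| < h} := by
  ext ω
  refine ⟨fun hω => ⟨fun i hi => hω i (by omega), hω _ le_rfl⟩, fun hω i hi => ?_⟩
  rcases Nat.lt_or_eq_of_le hi with hi | rfl
  · exact hω.1 i (by omega)
  · exact hω.2

theorem maxHorizontalDeviation_lt_iff (h n : ℕ) (ω : Ω) :
    maxHorizontalDeviation S n ω < h ↔ ω ∈ stripEvent S h n := by
  simp [maxHorizontalDeviation, Finset.sup'_lt_iff, stripEvent]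

theorem maxHorizontalDeviation_nonneg (n : ℕ) (ω : Ω) : 0 ≤ maxHorizontalDeviation S n ω :=
  (abs_nonneg (S 0 ω).1).trans
    (Finset.le_sup' (fun i => |(S i ω).1|) (Finset.mem_range.2 (Nat.succ_pos n)))

variable [MeasurableSpace Ω] {μ : Measure Ω}

/-- The probability that the first coordinate leaves `(-h, h)` exactly at the positive time `n`. -/
noncomputable def exitProb (μ : Measure Ω) (S : ℕ → Ω → ℤ × ℤ) (h : ℕ) : ℕ → ℝ
  | 0 => 0
  | n + 1 => μ.real (stripEvent S h n \ stripEvent S h (n + 1))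

theorem exitProb_nonneg (h n : ℕ) : 0 ≤ exitProb μ S h n := by
  cases n
  · exact le_rfl
  · exact measureReal_nonneg

theorem measurableSet_stripEvent (hS : IsSimpleRandomWalk combGraph (0, 0) μ S) (h n : ℕ) :
    MeasurableSet (stripEvent S h n) := by
  have : stripEvent S h n = ⋂ i, ⋂ (_ : i ≤ n), S i ⁻¹' {p : ℤ × ℤ | |p.1| < h} := by
    ext ω; simp [stripEvent]
  rw [this]
  exact MeasurableSet.iInter fun i => MeasurableSet.iInter fun _ =>
    hS.measurable i MeasurableSet.of_discrete

variable [IsProbabilityMeasure μ]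

theorem measureReal_compl_stripEvent (hS : IsSimpleRandomWalk combGraph (0, 0) μ S) {h : ℕ}
    (hh : 0 < h) (n : ℕ) :
    μ.real (stripEvent S h n)ᶜ = ∑ k ∈ Finset.range (n + 1), exitProb μ S h k := by
  induction n with
  | zero =>
    simp only [zero_add, Finset.sum_range_one, exitProb]
    rw [measureReal_def, ENNReal.toReal_eq_zero_iff]
    left
    rw [← mem_ae_iff]
    filter_upwards [hS.start] with ω hω i hi
    rw [Nat.le_zero.1 hi, hω]
    simpa using hh
  | succ n ih =>
    rw [Finset.sum_range_succ, ← ih, exitProb, ← measureReal_union]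
    · congr 1
      rw [stripEvent_succ]
      ext ω
      simp only [Set.mem_union, Set.mem_compl_iff, Set.mem_inter_iff, Set.mem_sdiff]
      tauto
    · exact Set.disjoint_left.2 fun ω h1 h2 => h1 h2.1
    · exact (measurableSet_stripEvent hS h n).diff (measurableSet_stripEvent hS h (n + 1))

/-- One step of the discounted martingale stopped at the exit: walks inside at time `n` either stay
or leave, and the latter collect the boundary value `cosh (t h)`. -/
theorem setLIntegral_stripEvent_combHarmonic (hS : IsSimpleRandomWalk combGraph (0, 0) μ S)
    {t z : ℝ} (hz0 : 0 < z) (hz : z * (1 + Real.cosh t ^ 2) = 2 * Real.cosh t) (h n : ℕ) :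
    ENNReal.ofReal z * (∫⁻ ω in stripEvent S h (n + 1),
        ENNReal.ofReal (combHarmonic t h (S (n + 1) ω)) ∂μ +
      ENNReal.ofReal (Real.cosh (t * h)) * μ (stripEvent S h n \ stripEvent S h (n + 1))) =
    ∫⁻ ω in stripEvent S h n, ENNReal.ofReal (combHarmonic t h (S n ω)) ∂μ := by
  have hA := measurableSet_stripEvent hS h n
  have hA' := measurableSet_stripEvent hS h (n + 1)
  have hsub : stripEvent S h (n + 1) ⊆ stripEvent S h n := by
    rw [stripEvent_succ]; exact Set.inter_subset_left
  have h1 : ∫⁻ ω in stripEvent S h n \ stripEvent S h (n + 1),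
      ENNReal.ofReal (combHarmonic t h (S (n + 1) ω)) ∂μ =
      ENNReal.ofReal (Real.cosh (t * h)) * μ (stripEvent S h n \ stripEvent S h (n + 1)) := by
    rw [← setLIntegral_const]
    refine setLIntegral_congr_fun (hA.diff hA') fun ω hω => ?_
    rw [stripEvent_succ] at hω
    have hn : ¬ |(S (n + 1) ω).1| < h := fun hc => hω.2 ⟨hω.1, hc⟩
    simp only [combHarmonic, if_neg hn]
  have h2 := setLIntegral_combGraph_succ hS n {p : ℤ × ℤ | |p.1| < h}
    fun p => ENNReal.ofReal (combHarmonic t h p)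
  have h3 := lintegral_inter_add_sdiff (μ := μ)
    (fun ω => ENNReal.ofReal (combHarmonic t h (S (n + 1) ω))) (stripEvent S h n) hA'
  rw [Set.inter_eq_self_of_subset_right hsub, h1] at h3
  rw [h3]
  refine (congrArg _ h2).trans ?_
  rw [← lintegral_const_mul' _ _ ENNReal.ofReal_ne_top]
  refine setLIntegral_congr_fun hA fun ω hω => ?_
  have h4 := sum_combHarmonic_combStep hz (hω n le_rfl)
  rw [← h4, ENNReal.ofReal_mul hz0.le, ENNReal.ofReal_div_of_pos (by norm_num),
    ENNReal.ofReal_sum_of_nonneg fun _ _ => combHarmonic_nonneg _ _ _, ENNReal.ofReal_ofNat]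

theorem setLIntegral_combHarmonic_le (h n : ℕ) (t : ℝ) :
    ∫⁻ ω in stripEvent S h n, ENNReal.ofReal (combHarmonic t h (S n ω)) ∂μ ≤
      ENNReal.ofReal (Real.cosh (t * h)) := by
  refine (setLIntegral_le_lintegral _ _).trans
    ((lintegral_mono fun ω => ENNReal.ofReal_le_ofReal (combHarmonic_le _ _ _)).trans ?_)
  simp

/-- The one-step identity telescopes from the value `1` at the origin. The remainder `z ^ n * l n`
vanishes because `l n` is bounded by `cosh (t h)`, so no separate argument that the walk leaves the
strip is needed. -/
theorem hasSum_exitProb_mul_pow (hS : IsSimpleRandomWalk combGraph (0, 0) μ S) {t z : ℝ}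
    (hz0 : 0 < z) (hz1 : z < 1) (hz : z * (1 + Real.cosh t ^ 2) = 2 * Real.cosh t) {h : ℕ}
    (hh : 0 < h) :
    HasSum (fun k : ℕ => exitProb μ S h k * z ^ k) (Real.cosh (t * h))⁻¹ := by
  have hc := Real.cosh_pos (t * h)
  set l : ℕ → ℝ := fun n =>
    (∫⁻ ω in stripEvent S h n, ENNReal.ofReal (combHarmonic t h (S n ω)) ∂μ).toReal with hl
  have hle := setLIntegral_combHarmonic_le (μ := μ) (S := S) h (t := t)
  have hl0 : ∀ n, 0 ≤ l n := fun n => ENNReal.toReal_nonneg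
  have hl1 : ∀ n, l n ≤ Real.cosh (t * h) := fun n => ENNReal.toReal_le_of_le_ofReal hc.le (hle n)
  have hrec : ∀ n, z * (l (n + 1) + Real.cosh (t * h) * exitProb μ S h (n + 1)) = l n := by
    intro n
    have h1 := congrArg ENNReal.toReal (setLIntegral_stripEvent_combHarmonic hS hz0 hz h n)
    rw [ENNReal.toReal_mul, ENNReal.toReal_add
      (ne_top_of_le_ne_top ENNReal.ofReal_ne_top (hle (n + 1)))
      (ENNReal.mul_ne_top ENNReal.ofReal_ne_top (measure_ne_top _ _)), ENNReal.toReal_mul,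
      ENNReal.toReal_ofReal hz0.le, ENNReal.toReal_ofReal hc.le] at h1
    exact h1
  have hinit : l 0 = 1 := by
    have h1 : ∫⁻ ω in stripEvent S h 0, ENNReal.ofReal (combHarmonic t h (S 0 ω)) ∂μ =
        ∫⁻ ω, 1 ∂μ := by
      have hae : stripEvent S h 0 =ᵐ[μ] Set.univ := by
        rw [Filter.eventuallyEq_univ]
        filter_upwards [hS.start] with ω hω i hi
        rw [Nat.le_zero.1 hi, hω]
        simpa using hh
      rw [setLIntegral_congr hae, setLIntegral_univ]
      refine lintegral_congr_ae ?_
      filter_upwards [hS.start] with ω hω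
      simp [hω, combHarmonic, hh]
    simp [hl, h1]
  have hsum : ∀ n, Real.cosh (t * h) * ∑ k ∈ Finset.range (n + 1), exitProb μ S h k * z ^ k =
      1 - z ^ n * l n := by
    intro n
    induction n with
    | zero => simp [exitProb, hinit]
    | succ n ih =>
      rw [Finset.sum_range_succ, mul_add, ih, ← hrec n]
      ring
  rw [hasSum_iff_tendsto_nat_of_nonneg
    fun k => mul_nonneg (exitProb_nonneg h k) (pow_nonneg hz0.le k), ← Filter.tendsto_add_atTop_iff_nat 1]
  have hz' : Filter.Tendsto (fun n => z ^ n * l n) Filter.atTop (nhds 0) := by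
    have h1 := (tendsto_pow_atTop_nhds_zero_of_lt_one hz0.le hz1).mul_const (Real.cosh (t * h))
    rw [zero_mul] at h1
    exact squeeze_zero (fun n => mul_nonneg (pow_nonneg hz0.le n) (hl0 n))
      (fun n => mul_le_mul_of_nonneg_left (hl1 n) (pow_nonneg hz0.le n)) h1
  have h2 := (hz'.const_sub 1).const_mul (Real.cosh (t * h))⁻¹
  rw [sub_zero, mul_one] at h2
  refine h2.congr fun n => ?_
  rw [← hsum n, inv_mul_cancel_left₀ hc.ne']

theorem exitProb_eq_zero (hS : IsSimpleRandomWalk combGraph (0, 0) μ S) {h k : ℕ} (hk : k < h) :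
    exitProb μ S h k = 0 := by
  cases k with
  | zero => rfl
  | succ k =>
    rw [exitProb, measureReal_def, ENNReal.toReal_eq_zero_iff]
    left
    refine measure_mono_null (t := {ω | ¬ |(S (k + 1) ω).1| ≤ (k + 1 : ℕ)}) ?_
      (ae_abs_fst_le hS (k + 1))
    rw [stripEvent_succ]
    intro ω hω hc
    refine hω.2 ⟨hω.1, ?_⟩
    have : |(S (k + 1) ω).1| ≤ (k + 1 : ℕ) := hc
    change |(S (k + 1) ω).1| < (h : ℤ)
    omega

/-- A natural number `m` counts the levels `h + 1 ≤ m`; levels above `n` are almost surely not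
reached. -/
theorem maxHorizontalDeviation_eq_sum_indicator (hS : IsSimpleRandomWalk combGraph (0, 0) μ S)
    (n : ℕ) : (fun ω => (maxHorizontalDeviation S n ω : ℝ)) =ᵐ[μ]
      fun ω => ∑ h ∈ Finset.range n, (stripEvent S (h + 1) n)ᶜ.indicator 1 ω := by
  filter_upwards [ae_all_iff.2 (ae_abs_fst_le hS)] with ω hω
  have h1 : maxHorizontalDeviation S n ω ≤ n := Finset.sup'_le _ _ fun i hi => (hω i).trans (by
    rw [Finset.mem_range] at hi; omega)
  obtain ⟨m, hm⟩ := Int.eq_ofNat_of_zero_le (maxHorizontalDeviation_nonneg (S := S) n ω)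
  have h2 : ∀ h : ℕ, ω ∈ (stripEvent S (h + 1) n)ᶜ ↔ h < m := fun h => by
    rw [Set.mem_compl_iff, ← maxHorizontalDeviation_lt_iff, hm]; omega
  classical
  rw [Finset.sum_congr rfl fun h _ => Set.indicator_apply _ _ _]
  simp only [h2, Pi.one_apply]
  rw [← Finset.sum_filter, Finset.sum_const, hm,
    show (Finset.range n).filter (· < m) = Finset.range m by ext; simp; omega]
  simp

theorem integrable_indicator_compl_stripEvent (hS : IsSimpleRandomWalk combGraph (0, 0) μ S)
    (h n : ℕ) : Integrable ((stripEvent S h n)ᶜ.indicator (1 : Ω → ℝ)) μ :=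
  (integrable_const (1 : ℝ)).indicator (measurableSet_stripEvent hS h n).compl

theorem integrable_maxHorizontalDeviation (hS : IsSimpleRandomWalk combGraph (0, 0) μ S) (n : ℕ) :
    Integrable (fun ω => (maxHorizontalDeviation S n ω : ℝ)) μ := by
  refine Integrable.congr ?_ (maxHorizontalDeviation_eq_sum_indicator hS n).symm
  exact integrable_finsetSum _ fun h _ => integrable_indicator_compl_stripEvent hS (h + 1) n

/-- The expected growth of the maximal horizontal deviation at time `k`. -/
noncomputable def deviationIncrement (μ : Measure Ω) (S : ℕ → Ω → ℤ × ℤ) (k : ℕ) : ℝ :=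
  ∑ h ∈ Finset.range k, exitProb μ S (h + 1) k

/-- Exit from level `h + 1` takes at least `h + 1` steps, so the increment does not depend on `n`.
The expectations are thus partial sums of a single sequence, as Karamata's theorem requires. -/
theorem sum_range_exitProb (hS : IsSimpleRandomWalk combGraph (0, 0) μ S) {n k : ℕ} (hk : k ≤ n) :
    ∑ h ∈ Finset.range n, exitProb μ S (h + 1) k = deviationIncrement μ S k := by
  refine (Finset.sum_subset (Finset.range_mono hk) fun h _ hh => exitProb_eq_zero hS ?_).symm
  rw [Finset.mem_range] at hh
  omega

theorem integral_maxHorizontalDeviation (hS : IsSimpleRandomWalk combGraph (0, 0) μ S) (n : ℕ) :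
    ∫ ω, (maxHorizontalDeviation S n ω : ℝ) ∂μ =
      ∑ k ∈ Finset.range (n + 1), deviationIncrement μ S k := by
  rw [integral_congr_ae (maxHorizontalDeviation_eq_sum_indicator hS n),
    integral_finsetSum _ fun h _ => integrable_indicator_compl_stripEvent hS (h + 1) n]
  have h1 : ∀ h, ∫ ω, (stripEvent S (h + 1) n)ᶜ.indicator 1 ω ∂μ =
      ∑ k ∈ Finset.range (n + 1), exitProb μ S (h + 1) k := fun h => by
    rw [integral_indicator_one (measurableSet_stripEvent hS (h + 1) n).compl,
      measureReal_compl_stripEvent hS h.succ_pos]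
  simp only [h1]
  rw [Finset.sum_comm]
  refine Finset.sum_congr rfl fun k hk => sum_range_exitProb hS ?_
  rw [Finset.mem_range] at hk
  omega

/-- Tonelli for a nonnegative double series: the sums over `k` at fixed `h` are known, and the order
is then exchanged. -/
theorem hasSum_deviationIncrement_mul_pow (hS : IsSimpleRandomWalk combGraph (0, 0) μ S) {z : ℝ}
    (hz0 : 0 < z) (hz1 : z < 1) :
    HasSum (fun k : ℕ => deviationIncrement μ S k * z ^ k)
      (∑' h : ℕ, (Real.cosh (combAngle z * (h + 1 : ℕ)))⁻¹) := by
  have h1 : ∀ h : ℕ, HasSum (fun k : ℕ => exitProb μ S (h + 1) k * z ^ k)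
      (Real.cosh (combAngle z * (h + 1 : ℕ)))⁻¹ := fun h =>
    hasSum_exitProb_mul_pow hS hz0 hz1 (mul_one_add_cosh_combAngle_sq hz0 hz1) h.succ_pos
  have h2 := (summable_nat_add_iff 1).2 (summable_inv_cosh (combAngle_pos hz0 hz1))
  have h3 : Summable fun x : ℕ × ℕ => exitProb μ S (x.1 + 1) x.2 * z ^ x.2 := by
    refine (summable_prod_of_nonneg fun x =>
      mul_nonneg (exitProb_nonneg _ _) (pow_nonneg hz0.le _)).2 ⟨fun h => (h1 h).summable, ?_⟩
    simpa only [(h1 _).tsum_eq] using h2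
  have h4 : HasSum (fun x : ℕ × ℕ => exitProb μ S (x.1 + 1) x.2 * z ^ x.2)
      (∑' h : ℕ, (Real.cosh (combAngle z * (h + 1 : ℕ)))⁻¹) := by
    have h5 := h3.hasSum
    rwa [← (h5.prod_fiberwise h1).tsum_eq] at h5
  refine ((Equiv.prodComm ℕ ℕ).hasSum_iff.2 h4).prod_fiberwise fun k => ?_
  rw [deviationIncrement, Finset.sum_mul]
  refine hasSum_sum_of_ne_finset_zero fun h hh => ?_
  rw [Finset.mem_range] at hh
  simp [exitProb_eq_zero hS (show k < h + 1 by omega)]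

end Walk

/-! ### Conclusion -/

theorem mainTheorem2 {Ω : Type*} [MeasurableSpace Ω] (μ : Measure Ω) [IsProbabilityMeasure μ]
    (S : ℕ → Ω → ℤ × ℤ) (hS : IsSimpleRandomWalk combGraph (0, 0) μ S) :
    (∀ n : ℕ, Integrable (fun ω => (maxHorizontalDeviation S n ω : ℝ)) μ) ∧
    Asymptotics.IsEquivalent Filter.atTop
      (fun n : ℕ => ∫ ω, (maxHorizontalDeviation S n ω : ℝ) ∂μ)
      (fun n : ℕ => (2 : ℝ) ^ (-(7 / 4) : ℝ) * Real.pi / Real.Gamma (5 / 4)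
        * (n : ℝ) ^ (1 / 4 : ℝ)) := by
  refine ⟨integrable_maxHorizontalDeviation hS, ?_⟩
  -- Nonnegativity of the increments is the Tauberian condition.
  have hb : ∀ k, 0 ≤ deviationIncrement μ S k :=
    fun k => Finset.sum_nonneg fun h _ => exitProb_nonneg _ _
  have hsum : ∀ s : ℝ, 0 < s →
      HasSum (fun k : ℕ => deviationIncrement μ S k * Real.exp (-(s * k)))
        (∑' h : ℕ, (Real.cosh (combAngle (Real.exp (-s)) * (h + 1 : ℕ)))⁻¹) := fun s hs => by
    have h1 := hasSum_deviationIncrement_mul_pow hS (Real.exp_pos (-s))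
      (Real.exp_lt_one_iff.2 (by linarith))
    simp only [← Real.exp_nat_mul] at h1
    simpa only [mul_neg, mul_comm] using h1
  have hlim : Filter.Tendsto (fun s : ℝ => s ^ (1 / 4 : ℝ) *
      ∑' k : ℕ, deviationIncrement μ S k * Real.exp (-(s * k))) (nhdsWithin 0 (Set.Ioi 0))
      (nhds ((1 / 8 : ℝ) ^ (1 / 4 : ℝ) * (Real.pi / 2))) := by
    refine tendsto_rpow_mul_tsum_inv_cosh.congr' ?_
    filter_upwards [self_mem_nhdsWithin] with s hs
    rw [(hsum s hs).tsum_eq]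
  have key := tendsto_sum_div_rpow_of_tendsto_abelMean hb (by norm_num : (0 : ℝ) < 1 / 4)
    (fun s hs => (hsum s hs).summable) hlim
  have hconst : (1 / 8 : ℝ) ^ (1 / 4 : ℝ) * (Real.pi / 2) / Real.Gamma (1 / 4 + 1) =
      (2 : ℝ) ^ (-(7 / 4) : ℝ) * Real.pi / Real.Gamma (5 / 4) := by
    have h1 : (1 / 8 : ℝ) ^ (1 / 4 : ℝ) = (2 : ℝ) ^ (-(3 / 4) : ℝ) := by
      rw [show (1 / 8 : ℝ) = (2 : ℝ) ^ (-3 : ℝ) by norm_num [Real.rpow_neg], ← Real.rpow_mul (by norm_num)]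
      norm_num
    have h2 : (2 : ℝ) ^ (-(7 / 4) : ℝ) = (2 : ℝ) ^ (-(3 / 4) : ℝ) / 2 := by
      rw [show (-(7 / 4) : ℝ) = -(3 / 4) - 1 by norm_num, Real.rpow_sub_one (by norm_num)]
    rw [h1, h2, show (1 / 4 + 1 : ℝ) = 5 / 4 by norm_num]
    ring
  rw [hconst] at key
  have hC : (2 : ℝ) ^ (-(7 / 4) : ℝ) * Real.pi / Real.Gamma (5 / 4) ≠ 0 := by
    have := Real.Gamma_pos_of_pos (show (0 : ℝ) < 5 / 4 by norm_num)
    positivity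
  refine (Asymptotics.isEquivalent_iff_tendsto_one ?_).2 ?_
  · filter_upwards [Filter.eventually_gt_atTop 0] with n hn
    have : (0 : ℝ) < n := by exact_mod_cast hn
    exact mul_ne_zero hC (by positivity)
  · have h1 := key.div_const ((2 : ℝ) ^ (-(7 / 4) : ℝ) * Real.pi / Real.Gamma (5 / 4))
    rw [div_self hC] at h1
    refine h1.congr fun n => ?_
    rw [Pi.div_apply, integral_maxHorizontalDeviation hS, div_div, mul_comm _ ((n : ℝ) ^ _)]
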